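/- Let $G$ be a finite simple connected graph of order $n$ whose independence number $\alpha(G)$ equals $n-2$. For a set $I$ of reals let $m_G I$ denote the number of Laplacian eigenvalues of $G$ in $I$, that is, of roots in $I$, counted with multiplicity, of the characteristic polynomial of the Laplacian matrix $L(G)=D(G)-A(G)$. For integers $p\ge r\ge 0$ and $q\ge 0$, let $B(p,q,r)$ be the graph of order $p+q+r+2$ with vertices $u,v,u_1,\dots,u_p,w_1,\dots,w_q,v_1,\dots,v_r$ and edges $uu_i$ $(1\le i\le p)$, $uw_j$ and $vw_j$ $(1\le j\le q)$, and $vv_k$ $(1\le k\le r)$; let $B'(p,q,r)$ be the graph obtained from $B(p,q,r)$ by adding the edge $uv$. Then $m_G[0,n-\alpha(G)]=\alpha(G)$ if and only if, for some integers $p\ge r\ge 0$ and $q\ge 0$, $G$ is isomorphic to one of the following graphs: 1. $B(p,q,r)$ with $p+q+r\ge 3$; 2. $B'(p,0,r)$ with $pr\ge 2$; 3. $B'(p,q,r)$ with $q\ne 0$. -/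

import Mathlib

/-- `lapEigCount G I` is `m_G I`: the number of Laplacian eigenvalues of `G` in the set `I`, i.e. of
roots of the characteristic polynomial of the Laplacian matrix `D(G) - A(G)`, counted with
multiplicity. -/
noncomputable def lapEigCount {V : Type*} [Fintype V] [DecidableEq V] (G : SimpleGraph V)
    [DecidableRel G.Adj] (I : Set ℝ) : ℕ :=
  open Classical in (G.lapMatrix ℝ).charpoly.roots.countP (fun x => x ∈ I)

/-- The vertices of the binary star graphs with parameters `p, q, r`: two centers `u` and `v`, then
`p` private neighbours of `u`, `q` common neighbours of `u` and `v`, and `r` private neighbours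
of `v`. -/
inductive BinaryStarVertex (p q r : ℕ) : Type
  | u : BinaryStarVertex p q r
  | v : BinaryStarVertex p q r
  | left (i : Fin p) : BinaryStarVertex p q r
  | mid (i : Fin q) : BinaryStarVertex p q r
  | right (i : Fin r) : BinaryStarVertex p q r
  deriving DecidableEq, Fintype

/-- The edges of `B(p,q,r)`, each listed in one orientation. -/
inductive BinaryStarEdge (p q r : ℕ) : BinaryStarVertex p q r → BinaryStarVertex p q r → Prop
  | u_left (i : Fin p) : BinaryStarEdge p q r .u (.left i)
  | u_mid (i : Fin q) : BinaryStarEdge p q r .u (.mid i)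
  | v_mid (i : Fin q) : BinaryStarEdge p q r .v (.mid i)
  | v_right (i : Fin r) : BinaryStarEdge p q r .v (.right i)

/-- The binary star graph `B(p,q,r)`: the stars with centers `u` and `v`, with `p + q` and `q + r`
leaves, glued along `q` leaves of each. -/
def binaryStar (p q r : ℕ) : SimpleGraph (BinaryStarVertex p q r) :=
  SimpleGraph.fromRel (BinaryStarEdge p q r)

/-- The binary star graph `B'(p,q,r)`: `B(p,q,r)` together with the edge `uv`. -/
def binaryStar' (p q r : ℕ) : SimpleGraph (BinaryStarVertex p q r) :=
  binaryStar p q r ⊔ SimpleGraph.edge .u .v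

/-! A largest independent set misses exactly two vertices `a`, `b`. Every edge meets them, and
connectedness makes every other vertex adjacent to one of them, so `G` is some `B(p,q,r)` or
`B'(p,q,r)` (`SimpleGraph.Connected.exists_iso_binaryStar`). Since n - α = 2, the question is how
many Laplacian eigenvalues exceed 2, and subspaces decide this through the quadratic form
(`finrank_le_lapEigCount`, `lapEigCount_add_finrank_le`). At most two exceed 2: on vectors vanishing
at both centers the form is at most 2|x|². In the listed cases two do: on the plane
`centerExtension` the form minus 2|x|² is a positive definite binary form. In the remaining cases at
most one does: a suitable linear condition on the center values already keeps the form at most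
2|x|². -/

open Matrix Module

/-! ### Counting eigenvalues by subspaces -/

/-- A real symmetric matrix is diagonal in suitable orthonormal coordinates. -/
theorem Matrix.IsHermitian.exists_linearMap_diagonalizing {n : Type*} [Fintype n] [DecidableEq n]
    {A : Matrix n n ℝ} (hA : A.IsHermitian) :
    ∃ y : (n → ℝ) →ₗ[ℝ] (n → ℝ), ∀ x, x ⬝ᵥ x = ∑ i, y x i ^ 2 ∧
      x ⬝ᵥ (A *ᵥ x) = ∑ i, hA.eigenvalues i * y x i ^ 2 := by
  set U : Matrix n n ℝ := (hA.eigenvectorUnitary : Matrix n n ℝ) with hU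
  have hUU : U * star U = 1 := Unitary.coe_mul_star_self hA.eigenvectorUnitary
  have hspec : A = U * diagonal hA.eigenvalues * star U := by
    conv_lhs => rw [hA.spectral_theorem]
    rw [Unitary.conjStarAlgAut_apply]
    rfl
  have hvec (x : n → ℝ) : x ᵥ* U = star U *ᵥ x := by
    rw [star_eq_conjTranspose, conjTranspose_eq_transpose_of_trivial, mulVec_transpose]
  refine ⟨(star U).mulVecLin, fun x => ⟨?_, ?_⟩⟩
  · have h : x ⬝ᵥ ((U * star U) *ᵥ x) = ∑ i, (star U *ᵥ x) i ^ 2 := by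
      rw [← mulVec_mulVec, dotProduct_mulVec, hvec]
      simp [dotProduct, sq]
    rwa [hUU, one_mulVec] at h
  · conv_lhs => rw [hspec]
    rw [← mulVec_mulVec, ← mulVec_mulVec, dotProduct_mulVec, hvec]
    simp only [dotProduct, mulVec_diagonal, mulVecLin_apply]
    exact Finset.sum_congr rfl fun i _ => by ring

/-- If no nonzero vector of a subspace has all its eigencoordinates in `s` equal to zero, then the
dimension of the subspace is at most the size of `s`. -/
theorem finrank_le_card_of_coords_injOn {n : Type*} [Fintype n] (W : Submodule ℝ (n → ℝ))
    (y : (n → ℝ) →ₗ[ℝ] (n → ℝ)) (s : Finset n)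
    (h : ∀ x ∈ W, (∀ i ∈ s, y x i = 0) → x = 0) : finrank ℝ W ≤ s.card := by
  let f : W →ₗ[ℝ] (s → ℝ) := (LinearMap.funLeft ℝ ℝ (fun i : s => (i : n))) ∘ₗ y ∘ₗ W.subtype
  have hf : Function.Injective f := by
    rw [injective_iff_map_eq_zero]
    intro x hx
    exact Subtype.ext (h x x.2 fun i hi => congrFun hx ⟨i, hi⟩)
  simpa using LinearMap.finrank_le_finrank_of_injective hf

/-- A vector of `W` whose coordinates for eigenvalues at most `c` vanish satisfies both bounds, so
equality holds term by term and kills the other coordinates. -/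
theorem Matrix.IsHermitian.finrank_le_card_eigenvalues_le {n : Type*} [Fintype n] [DecidableEq n]
    {A : Matrix n n ℝ} (hA : A.IsHermitian) (c : ℝ) (W : Submodule ℝ (n → ℝ))
    (hW : ∀ x ∈ W, x ⬝ᵥ (A *ᵥ x) ≤ c * (x ⬝ᵥ x)) :
    finrank ℝ W ≤ (Finset.univ.filter fun i => hA.eigenvalues i ≤ c).card := by
  obtain ⟨y, hy⟩ := hA.exists_linearMap_diagonalizing
  refine finrank_le_card_of_coords_injOn W y _ fun x hx h0 => ?_
  have hle := hW x hx
  rw [(hy x).1, (hy x).2, Finset.mul_sum] at hle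
  have hterm (i : n) : c * y x i ^ 2 ≤ hA.eigenvalues i * y x i ^ 2 := by
    by_cases hi : hA.eigenvalues i ≤ c
    · simp [h0 i (by simpa using hi)]
    · exact mul_le_mul_of_nonneg_right (not_le.mp hi).le (sq_nonneg _)
  have heq := (Finset.sum_eq_sum_iff_of_le fun i _ => hterm i).mp
    (le_antisymm (Finset.sum_le_sum fun i _ => hterm i) hle)
  rw [← dotProduct_self_eq_zero, (hy x).1]
  refine Finset.sum_eq_zero fun i _ => ?_
  by_cases hi : hA.eigenvalues i ≤ c
  · simp [h0 i (by simpa using hi)]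
  · have h2 := heq i (Finset.mem_univ i)
    have h3 : (hA.eigenvalues i - c) * y x i ^ 2 = 0 := by linarith
    exact (mul_eq_zero.mp h3).resolve_left (by linarith [not_le.mp hi])

theorem Matrix.IsHermitian.finrank_le_card_lt_eigenvalues {n : Type*} [Fintype n] [DecidableEq n]
    {A : Matrix n n ℝ} (hA : A.IsHermitian) (c : ℝ) (W : Submodule ℝ (n → ℝ))
    (hW : ∀ x ∈ W, x ≠ 0 → c * (x ⬝ᵥ x) < x ⬝ᵥ (A *ᵥ x)) :
    finrank ℝ W ≤ (Finset.univ.filter fun i => ¬ hA.eigenvalues i ≤ c).card := by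
  obtain ⟨y, hy⟩ := hA.exists_linearMap_diagonalizing
  refine finrank_le_card_of_coords_injOn W y _ fun x hx h0 => ?_
  by_contra hne
  have hlt := hW x hx hne
  rw [(hy x).1, (hy x).2, Finset.mul_sum] at hlt
  refine absurd hlt (not_lt.mpr (Finset.sum_le_sum fun i _ => ?_))
  by_cases hi : hA.eigenvalues i ≤ c
  · exact mul_le_mul_of_nonneg_right hi (sq_nonneg _)
  · simp [h0 i (by simpa using hi)]

section lapEigCount
variable {V : Type*} [Fintype V] [DecidableEq V] (G : SimpleGraph V) [DecidableRel G.Adj]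

theorem lapEigCount_Icc_zero (c : ℝ) :
    lapEigCount G (Set.Icc 0 c) = (Finset.univ.filter fun i =>
      (G.isHermitian_lapMatrix (R := ℝ)).eigenvalues i ≤ c).card := by
  have hpos := (G.posSemidef_lapMatrix (R := ℝ)).eigenvalues_nonneg
  rw [lapEigCount, (G.isHermitian_lapMatrix (R := ℝ)).roots_charpoly_eq_eigenvalues,
    Multiset.countP_map, Finset.card_def, Finset.filter_val]
  refine congrArg Multiset.card ?_
  convert Multiset.filter_congr (s := Finset.univ.val) fun i _ => ?_
  simpa using fun _ => hpos i

theorem finrank_le_lapEigCount (c : ℝ) (W : Submodule ℝ (V → ℝ))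
    (hW : ∀ x ∈ W, x ⬝ᵥ (G.lapMatrix ℝ *ᵥ x) ≤ c * (x ⬝ᵥ x)) :
    finrank ℝ W ≤ lapEigCount G (Set.Icc 0 c) := by
  rw [lapEigCount_Icc_zero]
  exact IsHermitian.finrank_le_card_eigenvalues_le _ c W hW

theorem lapEigCount_add_finrank_le (c : ℝ) (W : Submodule ℝ (V → ℝ))
    (hW : ∀ x ∈ W, x ≠ 0 → c * (x ⬝ᵥ x) < x ⬝ᵥ (G.lapMatrix ℝ *ᵥ x)) :
    lapEigCount G (Set.Icc 0 c) + finrank ℝ W ≤ Fintype.card V := by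
  rw [lapEigCount_Icc_zero]
  have h := (G.isHermitian_lapMatrix (R := ℝ)).finrank_le_card_lt_eigenvalues c W hW
  have h2 := Finset.card_filter_add_card_filter_not (s := (Finset.univ : Finset V))
    (fun i => (G.isHermitian_lapMatrix (R := ℝ)).eigenvalues i ≤ c)
  rw [Finset.card_univ] at h2
  omega

end lapEigCount

theorem lapEigCount_congr {V V' : Type*} [Fintype V] [DecidableEq V] [Fintype V']
    [DecidableEq V'] {G : SimpleGraph V} [DecidableRel G.Adj] {G' : SimpleGraph V'}
    [DecidableRel G'.Adj] (e : G ≃g G') (I : Set ℝ) : lapEigCount G I = lapEigCount G' I := by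
  have h : G'.lapMatrix ℝ = Matrix.reindex e.toEquiv e.toEquiv (G.lapMatrix ℝ) := by
    ext i j
    have hdeg : G'.degree i = G.degree (e.toEquiv.symm i) := (e.symm.degree_eq i).symm
    have hadj : G'.Adj i j ↔ G.Adj (e.toEquiv.symm i) (e.toEquiv.symm j) :=
      e.symm.map_adj_iff.symm
    simp only [SimpleGraph.lapMatrix, SimpleGraph.degMatrix, reindex_apply, submatrix_apply,
      Matrix.sub_apply, diagonal_apply, SimpleGraph.adjMatrix_apply, hdeg, hadj]
    simp only [EmbeddingLike.apply_eq_iff_eq]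
  rw [lapEigCount, lapEigCount, h, charpoly_reindex]

/-! ### Adjacency and quadratic forms of binary stars -/

namespace BinaryStarVertex

theorem univ_sum {p q r : ℕ} {M : Type*} [AddCommMonoid M] (f : BinaryStarVertex p q r → M) :
    ∑ x, f x = f u + (f v + (∑ i, f (left i) + (∑ i, f (mid i) + ∑ i, f (right i)))) := by
  let e : Unit ⊕ Unit ⊕ Fin p ⊕ Fin q ⊕ Fin r ≃ BinaryStarVertex p q r :=
    { toFun := Sum.elim (fun _ => u) (Sum.elim (fun _ => v) (Sum.elim left (Sum.elim mid right)))
      invFun := fun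
        | u => .inl ()
        | v => .inr (.inl ())
        | left i => .inr (.inr (.inl i))
        | mid i => .inr (.inr (.inr (.inl i)))
        | right i => .inr (.inr (.inr (.inr i)))
      left_inv := by rintro (_ | _ | _ | _ | _) <;> rfl
      right_inv := by rintro (_ | _ | _ | _ | _) <;> rfl }
  rw [← e.sum_comp]
  simp [e]

end BinaryStarVertex

open BinaryStarVertex

theorem binaryStar_adj_iff {p q r : ℕ} (x y : BinaryStarVertex p q r) :
    (binaryStar p q r).Adj x y ↔ BinaryStarEdge p q r x y ∨ BinaryStarEdge p q r y x := by
  rw [binaryStar, SimpleGraph.fromRel_adj, and_iff_right_iff_imp]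
  rintro (h | h) <;> cases h <;> simp

theorem binaryStarEdge_iff {p q r : ℕ} (x y : BinaryStarVertex p q r) :
    BinaryStarEdge p q r x y ↔
      match x, y with
      | u, left _ => True
      | u, mid _ => True
      | v, mid _ => True
      | v, right _ => True
      | _, _ => False := by
  constructor
  · rintro (_ | _ | _ | _) <;> trivial
  · cases x <;> cases y <;> simp <;> constructor

theorem binaryStar'_adj_iff {p q r : ℕ} (x y : BinaryStarVertex p q r) :
    (binaryStar' p q r).Adj x y ↔
      (binaryStar p q r).Adj x y ∨ (x = u ∧ y = v ∨ x = v ∧ y = u) := by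
  rw [binaryStar', SimpleGraph.sup_adj, SimpleGraph.edge_adj]
  refine or_congr_right ?_
  rw [and_iff_left_iff_imp]
  rintro (⟨rfl, rfl⟩ | ⟨rfl, rfl⟩) <;> simp

section QuadraticForm
open Classical in
/-- The Laplacian quadratic form of `B(p,q,r)`. -/
theorem dotProduct_lapMatrix_binaryStar {p q r : ℕ} (x : BinaryStarVertex p q r → ℝ) :
    x ⬝ᵥ ((binaryStar p q r).lapMatrix ℝ *ᵥ x) =
      ∑ i, (x u - x (left i)) ^ 2 + ∑ i, ((x u - x (mid i)) ^ 2 + (x v - x (mid i)) ^ 2) +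
        ∑ i, (x v - x (right i)) ^ 2 := by
  rw [← toLinearMap₂'_apply', SimpleGraph.lapMatrix_toLinearMap₂']
  simp only [univ_sum, binaryStar_adj_iff, binaryStarEdge_iff]
  simp [Finset.sum_add_distrib]
  simp only [sub_sq_comm (x (left _)), sub_sq_comm (x (mid _)), sub_sq_comm (x (right _))]
  ring

open Classical in
/-- The Laplacian quadratic form of `B'(p,q,r)`. -/
theorem dotProduct_lapMatrix_binaryStar' {p q r : ℕ} (x : BinaryStarVertex p q r → ℝ) :
    x ⬝ᵥ ((binaryStar' p q r).lapMatrix ℝ *ᵥ x) =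
      (x u - x v) ^ 2 + x ⬝ᵥ ((binaryStar p q r).lapMatrix ℝ *ᵥ x) := by
  rw [dotProduct_lapMatrix_binaryStar, ← toLinearMap₂'_apply', SimpleGraph.lapMatrix_toLinearMap₂']
  simp only [univ_sum, binaryStar'_adj_iff, binaryStar_adj_iff, binaryStarEdge_iff]
  simp [Finset.sum_add_distrib]
  simp only [sub_sq_comm (x (left _)), sub_sq_comm (x (mid _)), sub_sq_comm (x (right _)),
    sub_sq_comm (x v) (x u)]
  ring

theorem dotProduct_self_binaryStarVertex {p q r : ℕ} (x : BinaryStarVertex p q r → ℝ) :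
    x ⬝ᵥ x = x u ^ 2 + x v ^ 2 + ∑ i, x (left i) ^ 2 + ∑ i, x (mid i) ^ 2 +
      ∑ i, x (right i) ^ 2 := by
  simp only [dotProduct, univ_sum, sq]
  ring

end QuadraticForm

/-- Multiply by `α` and complete the square. -/
theorem binary_quadratic_form_pos {α β γ : ℝ} (hα : 0 < α) (hdet : β ^ 2 < α * γ) {z : ℝ × ℝ}
    (hz : z ≠ 0) : 0 < α * z.1 ^ 2 + 2 * β * (z.1 * z.2) + γ * z.2 ^ 2 := by
  obtain ⟨a, b⟩ := z
  refine pos_of_mul_pos_right (a := α) ?_ hα.le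
  have h : α * (α * a ^ 2 + 2 * β * (a * b) + γ * b ^ 2) =
      (α * a + β * b) ^ 2 + (α * γ - β ^ 2) * b ^ 2 := by ring
  simp only
  rw [h]
  rcases eq_or_ne b 0 with rfl | hb
  · have ha : a ≠ 0 := by rintro rfl; exact hz rfl
    simp only [mul_zero, add_zero, ne_eq, OfNat.ofNat_ne_zero, not_false_eq_true, zero_pow]
    positivity
  · have : 0 < (α * γ - β ^ 2) * b ^ 2 := mul_pos (by linarith) (by positivity)
    positivity

/-! ### Test subspaces for the threshold 2 -/

theorem card_sub_finrank_le_finrank_ker {n F : Type*} [Fintype n] [AddCommGroup F] [Module ℝ F]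
    [FiniteDimensional ℝ F] (φ : (n → ℝ) →ₗ[ℝ] F) :
    Fintype.card n ≤ finrank ℝ (LinearMap.ker φ) + finrank ℝ F := by
  have h1 := LinearMap.finrank_range_add_finrank_ker φ
  have h2 := Submodule.finrank_le (LinearMap.range φ)
  rw [finrank_fintype_fun_eq_card] at h1
  omega

/-- Vectors on a binary star that are determined by their values at the two centers and on which
the Laplacian quadratic form is large. -/
def centerExtension (p q r : ℕ) : ℝ × ℝ →ₗ[ℝ] (BinaryStarVertex p q r → ℝ) where
  toFun z
    | u => z.1
    | v => z.2
    -- For a private neighbour of value t, (z.1 - t)² - 2t² is largest at t = -z.1. For a common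
    -- neighbour the excess is linear in t with slope -2(z.1 + z.2), so this t makes its
    -- contribution grow.
    | left _ => -z.1
    | mid _ => -(z.1 + z.2)
    | right _ => -z.2
  map_add' z w := by ext (_ | _) <;> (simp; try ring)
  map_smul' c z := by ext (_ | _) <;> (simp; try ring)

theorem centerExtension_injective (p q r : ℕ) : Function.Injective (centerExtension p q r) :=
  fun _ _ h => Prod.ext (congrFun h u) (congrFun h v)

section
variable {p q r : ℕ} (H : SimpleGraph (BinaryStarVertex p q r)) [DecidableRel H.Adj]

theorem lapEigCount_add_two_le
    (hH : ∀ z : ℝ × ℝ, z ≠ 0 → 2 * (centerExtension p q r z ⬝ᵥ centerExtension p q r z) <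
      centerExtension p q r z ⬝ᵥ (H.lapMatrix ℝ *ᵥ centerExtension p q r z)) :
    lapEigCount H (Set.Icc 0 2) + 2 ≤ Fintype.card (BinaryStarVertex p q r) := by
  have h := lapEigCount_add_finrank_le H 2 (LinearMap.range (centerExtension p q r)) (by
    rintro _ ⟨z, rfl⟩ hz
    exact hH z fun h => hz (by rw [h, map_zero]))
  rwa [LinearMap.finrank_range_of_inj (centerExtension_injective p q r), finrank_prod,
    finrank_self] at h

theorem card_le_lapEigCount_add {F : Type*} [AddCommGroup F] [Module ℝ F] [FiniteDimensional ℝ F]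
    (φ : (BinaryStarVertex p q r → ℝ) →ₗ[ℝ] F)
    (hH : ∀ x, φ x = 0 → x ⬝ᵥ (H.lapMatrix ℝ *ᵥ x) ≤ 2 * (x ⬝ᵥ x)) :
    Fintype.card (BinaryStarVertex p q r) ≤ lapEigCount H (Set.Icc 0 2) + finrank ℝ F :=
  (card_sub_finrank_le_finrank_ker φ).trans
    (Nat.add_le_add_right (finrank_le_lapEigCount H 2 _ fun x hx => hH x hx) _)

end

section
open Classical
variable {p q r : ℕ}

theorem centerExtension_excess (z : ℝ × ℝ) :
    centerExtension p q r z ⬝ᵥ ((binaryStar p q r).lapMatrix ℝ *ᵥ centerExtension p q r z) =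
      2 * (centerExtension p q r z ⬝ᵥ centerExtension p q r z) +
        ((3 * q + 2 * p - 2) * z.1 ^ 2 + 4 * q * (z.1 * z.2) +
          (3 * q + 2 * r - 2) * z.2 ^ 2) := by
  rw [dotProduct_lapMatrix_binaryStar, dotProduct_self_binaryStarVertex]
  simp only [centerExtension, LinearMap.coe_mk, AddHom.coe_mk, Finset.sum_const, Finset.card_univ,
    Fintype.card_fin, nsmul_eq_mul]
  ring

theorem lapEigCount_binaryStar_add_two_le (hq : q ≠ 0) (h : 3 ≤ p + q + r) :
    lapEigCount (binaryStar p q r) (Set.Icc 0 2) + 2 ≤ Fintype.card (BinaryStarVertex p q r) := by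
  refine lapEigCount_add_two_le _ fun z hz => ?_
  rw [centerExtension_excess, lt_add_iff_pos_right]
  have hq' : (1 : ℝ) ≤ q := by exact_mod_cast Nat.one_le_iff_ne_zero.mpr hq
  have hp' : (0 : ℝ) ≤ p := p.cast_nonneg
  have hr' : (0 : ℝ) ≤ r := r.cast_nonneg
  have h' : (3 : ℝ) ≤ p + q + r := by exact_mod_cast h
  convert binary_quadratic_form_pos (α := 3 * q + 2 * p - 2) (β := 2 * q)
    (γ := 3 * q + 2 * r - 2) (by linarith) ?_ hz using 1
  · ring
  -- The determinant condition is (3q+2p-2)(3q+2r-2) > 4q².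
  · nlinarith [mul_nonneg hp' hr']

theorem lapEigCount_binaryStar'_add_two_le (h : q ≠ 0 ∨ 2 ≤ p * r) :
    lapEigCount (binaryStar' p q r) (Set.Icc 0 2) + 2 ≤ Fintype.card (BinaryStarVertex p q r) := by
  refine lapEigCount_add_two_le _ fun z hz => ?_
  rw [dotProduct_lapMatrix_binaryStar', centerExtension_excess, add_left_comm,
    lt_add_iff_pos_right]
  have hp' : (0 : ℝ) ≤ p := p.cast_nonneg
  have hq' : (0 : ℝ) ≤ q := q.cast_nonneg
  have hr' : (0 : ℝ) ≤ r := r.cast_nonneg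
  -- The edge `uv` adds (z.1 - z.2)², which raises `α` and `γ` by 1 and lowers `β` by 1.
  convert binary_quadratic_form_pos (α := 3 * q + 2 * p - 1) (β := 2 * q - 1)
    (γ := 3 * q + 2 * r - 1) ?_ ?_ hz using 1
  · simp only [centerExtension, LinearMap.coe_mk, AddHom.coe_mk]
    ring
  · rcases h with h | h
    · have : (1 : ℝ) ≤ q := by exact_mod_cast Nat.one_le_iff_ne_zero.mpr h
      linarith
    · have : (1 : ℝ) ≤ p := by
        exact_mod_cast Nat.one_le_iff_ne_zero.mpr (by rintro rfl; simp at h)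
      linarith
  · rcases h with h | h
    · have : (1 : ℝ) ≤ q := by exact_mod_cast Nat.one_le_iff_ne_zero.mpr h
      nlinarith [mul_nonneg hp' hr', mul_nonneg hp' hq', mul_nonneg hq' hr']
    · have h1 : (2 : ℝ) ≤ p * r := by exact_mod_cast h
      have hp : (1 : ℝ) ≤ p := by
        exact_mod_cast Nat.one_le_iff_ne_zero.mpr (by rintro rfl; simp at h)
      have hr : (1 : ℝ) ≤ r := by
        exact_mod_cast Nat.one_le_iff_ne_zero.mpr (by rintro rfl; simp at h)
      nlinarith [mul_nonneg (sub_nonneg.mpr hp) (sub_nonneg.mpr hr), mul_nonneg hq' hq',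
        mul_nonneg hq' (sub_nonneg.mpr hp), mul_nonneg hq' hr']

/-- Private neighbours use (s - t)² ≤ 2s² + 2t². At a common neighbour the cross term is -2t(x u + x
v), which `hx` removes. -/
theorem dotProduct_lapMatrix_binaryStar_le (x : BinaryStarVertex p q r → ℝ)
    (hx : q = 0 ∨ x u + x v = 0) :
    x ⬝ᵥ ((binaryStar p q r).lapMatrix ℝ *ᵥ x) ≤
      2 * (x ⬝ᵥ x) + ((2 * p + q - 2) * x u ^ 2 + (2 * r + q - 2) * x v ^ 2) := by
  rw [dotProduct_lapMatrix_binaryStar, dotProduct_self_binaryStarVertex]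
  have h1 : ∑ i : Fin p, (x u - x (left i)) ^ 2 ≤ ∑ i : Fin p, (2 * x u ^ 2 + 2 * x (left i) ^ 2) :=
    Finset.sum_le_sum fun i _ => by nlinarith [sq_nonneg (x u + x (left i))]
  have h3 : ∑ i : Fin r, (x v - x (right i)) ^ 2 ≤
      ∑ i : Fin r, (2 * x v ^ 2 + 2 * x (right i) ^ 2) :=
    Finset.sum_le_sum fun i _ => by nlinarith [sq_nonneg (x v + x (right i))]
  have h2 : ∑ i : Fin q, ((x u - x (mid i)) ^ 2 + (x v - x (mid i)) ^ 2) =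
      ∑ i : Fin q, (x u ^ 2 + x v ^ 2 + 2 * x (mid i) ^ 2) := by
    rcases hx with rfl | hx
    · simp
    · refine Finset.sum_congr rfl fun i _ => ?_
      linear_combination (-2 * x (mid i)) * hx
  simp only [Finset.sum_add_distrib, Finset.sum_const, Finset.card_univ, Fintype.card_fin,
    nsmul_eq_mul, ← Finset.mul_sum] at h1 h2 h3 ⊢
  linarith

theorem dotProduct_lapMatrix_binaryStar_of_centers_eq_zero (x : BinaryStarVertex p q r → ℝ)
    (hu : x u = 0) (hv : x v = 0) :
    x ⬝ᵥ ((binaryStar p q r).lapMatrix ℝ *ᵥ x) ≤ 2 * (x ⬝ᵥ x) := by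
  simpa [hu, hv] using dotProduct_lapMatrix_binaryStar_le x (Or.inr (by simp [hu, hv]))

theorem card_le_lapEigCount_binaryStar_add_two :
    Fintype.card (BinaryStarVertex p q r) ≤ lapEigCount (binaryStar p q r) (Set.Icc 0 2) + 2 := by
  refine (card_le_lapEigCount_add _ ((LinearMap.proj u).prod (LinearMap.proj v))
    fun x hx => ?_).trans_eq (by rw [finrank_prod, finrank_self])
  exact dotProduct_lapMatrix_binaryStar_of_centers_eq_zero x (congrArg Prod.fst hx)
    (congrArg Prod.snd hx)

theorem card_le_lapEigCount_binaryStar'_add_two :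
    Fintype.card (BinaryStarVertex p q r) ≤ lapEigCount (binaryStar' p q r) (Set.Icc 0 2) + 2 := by
  refine (card_le_lapEigCount_add _ ((LinearMap.proj u).prod (LinearMap.proj v))
    fun x hx => ?_).trans_eq (by rw [finrank_prod, finrank_self])
  have hu : x u = 0 := congrArg Prod.fst hx
  have hv : x v = 0 := congrArg Prod.snd hx
  simpa [dotProduct_lapMatrix_binaryStar', hu, hv] using
    dotProduct_lapMatrix_binaryStar_of_centers_eq_zero x hu hv

theorem card_le_lapEigCount_binaryStar_add_one (h : p + q + r ≤ 2) :
    Fintype.card (BinaryStarVertex p q r) ≤ lapEigCount (binaryStar p q r) (Set.Icc 0 2) + 1 := by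
  refine (card_le_lapEigCount_add _ (LinearMap.proj (R := ℝ) (φ := fun _ => ℝ) u + LinearMap.proj v)
    fun x hx => ?_).trans_eq (by rw [finrank_self])
  -- On this hyperplane the bound exceeds 2|x|² by 2(p + q + r - 2)(x u)², which is not positive.
  have hx' : x u + x v = 0 := hx
  have hv : x v = - x u := by linarith
  have h' : (p + q + r : ℝ) ≤ 2 := by exact_mod_cast h
  have := dotProduct_lapMatrix_binaryStar_le x (Or.inr hx')
  rw [hv] at this
  nlinarith [sq_nonneg (x u)]

theorem card_le_lapEigCount_binaryStar'_add_one (hrp : r ≤ p) (h : p * r ≤ 1) :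
    Fintype.card (BinaryStarVertex p 0 r) ≤ lapEigCount (binaryStar' p 0 r) (Set.Icc 0 2) + 1 := by
  have hcases : r = 0 ∨ p = 1 ∧ r = 1 := by
    rcases Nat.eq_zero_or_pos r with hr | hr
    · exact .inl hr
    · have : p ≤ 1 := (Nat.le_mul_of_pos_right p hr).trans h
      omega
  rcases hcases with rfl | ⟨rfl, rfl⟩
  -- With x u = 0 the edge `uv` adds (x v)², absorbed by the term -2(x v)².
  · refine (card_le_lapEigCount_add _ (LinearMap.proj u : _ →ₗ[ℝ] ℝ)
      fun x hx => ?_).trans_eq (by rw [finrank_self])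
    have hu : x u = 0 := hx
    have := dotProduct_lapMatrix_binaryStar_le x (Or.inl rfl)
    rw [dotProduct_lapMatrix_binaryStar']
    rw [hu] at this ⊢
    push_cast at this
    nlinarith [sq_nonneg (x v)]
  -- For the path on four vertices, x u = x v cancels the edge `uv`, and both center coefficients
  -- are 0.
  · refine (card_le_lapEigCount_add _ (LinearMap.proj (R := ℝ) (φ := fun _ => ℝ) u - LinearMap.proj v)
      fun x hx => ?_).trans_eq (by rw [finrank_self])
    have hx' : x u - x v = 0 := hx
    have := dotProduct_lapMatrix_binaryStar_le x (Or.inl rfl)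
    rw [dotProduct_lapMatrix_binaryStar', hx']
    push_cast at this
    linarith
end

/-! ### Structure of the graphs with α = n - 2 -/

theorem not_connected_binaryStar_zero (p r : ℕ) : ¬ (binaryStar p 0 r).Connected := by
  intro h
  -- The indicator of the star around `u` is constant along edges but separates `u` from `v`.
  let f : BinaryStarVertex p 0 r → Bool
    | u => true
    | left _ => true
    | _ => false
  have hf : ∀ x y, (binaryStar p 0 r).Adj x y → f x = f y := by
    intro x y hxy
    rw [binaryStar_adj_iff] at hxy
    rcases hxy with (_ | ⟨⟨_, hi⟩⟩ | _ | _) | (_ | ⟨⟨_, hi⟩⟩ | _ | _) <;>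
      first | rfl | exact absurd hi (Nat.not_lt_zero _)
  obtain ⟨w⟩ := h.preconnected u v
  have key : ∀ x y, (binaryStar p 0 r).Walk x y → f x = f y := by
    intro x y w
    induction w with
    | nil => rfl
    | cons hxy _ ih => exact (hf _ _ hxy).trans ih
  simpa [f] using key u v w

section Structure
variable {V : Type*} {G : SimpleGraph V} {a b : V}

/-- If every edge meets `{a, b}` and every other vertex is adjacent to `a` or to `b`, then the graph
is a binary star with centers `a` and `b`. -/
theorem nonempty_iso_binaryStar_of_equiv (hab : a ≠ b)
    (hind : ∀ x y, x ≠ a → x ≠ b → y ≠ a → y ≠ b → ¬ G.Adj x y)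
    (hdom : ∀ x, x ≠ a → x ≠ b → G.Adj a x ∨ G.Adj b x) {p q r : ℕ}
    (el : Fin p ≃ {x // (x ≠ a ∧ x ≠ b) ∧ G.Adj a x ∧ ¬ G.Adj b x})
    (em : Fin q ≃ {x // (x ≠ a ∧ x ≠ b) ∧ G.Adj a x ∧ G.Adj b x})
    (er : Fin r ≃ {x // (x ≠ a ∧ x ≠ b) ∧ G.Adj b x ∧ ¬ G.Adj a x}) :
    Nonempty (G ≃g binaryStar p q r) ∨ Nonempty (G ≃g binaryStar' p q r) := by
  let g : BinaryStarVertex p q r → V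
    | u => a
    | v => b
    | left i => el i
    | mid i => em i
    | right i => er i
  have hl (i) := (el i).2
  have hm (i) := (em i).2
  have hr (i) := (er i).2
  have hg : Function.Bijective g := by
    constructor
    · rintro (_ | _ | i | i | i) (_ | _ | j | j | j) h
      all_goals first
        | rfl
        | exact congrArg _ (el.injective (Subtype.ext h))
        | exact congrArg _ (em.injective (Subtype.ext h))
        | exact congrArg _ (er.injective (Subtype.ext h))
        | (exfalso; dsimp only [g] at h; grind)
    · intro x
      by_cases ha : x = a
      · exact ⟨u, ha.symm⟩
      by_cases hb : x = b
      · exact ⟨v, hb.symm⟩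
      by_cases hxa : G.Adj a x
      · by_cases hxb : G.Adj b x
        · exact ⟨mid (em.symm ⟨x, ⟨ha, hb⟩, hxa, hxb⟩), by simp [g]⟩
        · exact ⟨left (el.symm ⟨x, ⟨ha, hb⟩, hxa, hxb⟩), by simp [g]⟩
      · exact ⟨right (er.symm ⟨x, ⟨ha, hb⟩, (hdom x ha hb).resolve_left hxa, hxa⟩), by simp [g]⟩
  by_cases h : G.Adj a b
  · refine .inr ⟨SimpleGraph.Iso.symm ⟨Equiv.ofBijective g hg, ?_⟩⟩
    rintro (_ | _ | i | i | i) (_ | _ | j | j | j)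
    all_goals
      simp only [Equiv.ofBijective_apply, binaryStar'_adj_iff, binaryStar_adj_iff,
        binaryStarEdge_iff, g]
      grind [SimpleGraph.adj_comm, SimpleGraph.irrefl]
  · refine .inl ⟨SimpleGraph.Iso.symm ⟨Equiv.ofBijective g hg, ?_⟩⟩
    rintro (_ | _ | i | i | i) (_ | _ | j | j | j)
    all_goals
      simp only [Equiv.ofBijective_apply, binaryStar_adj_iff, binaryStarEdge_iff, g]
      grind [SimpleGraph.adj_comm, SimpleGraph.irrefl]

theorem exists_iso_binaryStar [Finite V] (hab : a ≠ b)
    (hind : ∀ x y, x ≠ a → x ≠ b → y ≠ a → y ≠ b → ¬ G.Adj x y)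
    (hdom : ∀ x, x ≠ a → x ≠ b → G.Adj a x ∨ G.Adj b x) :
    ∃ p q r, r ≤ p ∧ (Nonempty (G ≃g binaryStar p q r) ∨ Nonempty (G ≃g binaryStar' p q r)) := by
  -- Exchanging `a` and `b` swaps `p` and `r`.
  wlog hle : Nat.card {x // (x ≠ a ∧ x ≠ b) ∧ G.Adj b x ∧ ¬ G.Adj a x} ≤
      Nat.card {x // (x ≠ a ∧ x ≠ b) ∧ G.Adj a x ∧ ¬ G.Adj b x} generalizing a b
  · refine this hab.symm (fun x y h1 h2 h3 h4 => hind x y h2 h1 h4 h3)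
      (fun x h1 h2 => (hdom x h2 h1).symm) ?_
    simp only [and_comm (a := _ ≠ b)]
    exact (not_le.mp hle).le
  exact ⟨_, _, _, hle, nonempty_iso_binaryStar_of_equiv hab hind hdom
    (Finite.equivFin _).symm (Finite.equivFin _).symm (Finite.equivFin _).symm⟩

end Structure

theorem SimpleGraph.Connected.exists_iso_binaryStar {V : Type*} [Fintype V] {G : SimpleGraph V}
    (hconn : G.Connected) (hα : G.indepNum + 2 = Fintype.card V) :
    ∃ p q r, r ≤ p ∧ (Nonempty (G ≃g binaryStar p q r) ∨ Nonempty (G ≃g binaryStar' p q r)) := by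
  classical
  obtain ⟨s, hs, hcard⟩ := G.exists_isNIndepSet_indepNum
  have hc : sᶜ.card = 2 := by rw [Finset.card_compl]; omega
  obtain ⟨a, b, hab, hsab⟩ := Finset.card_eq_two.mp hc
  have hmem (x : V) (ha : x ≠ a) (hb : x ≠ b) : x ∈ s := by
    by_contra hx
    have : x ∈ sᶜ := Finset.mem_compl.mpr hx
    simp [hsab, ha, hb] at this
  have hind (x y) (h1 : x ≠ a) (h2 : x ≠ b) (h3 : y ≠ a) (h4 : y ≠ b) : ¬ G.Adj x y := fun h =>
    hs (hmem x h1 h2) (hmem y h3 h4) h.ne h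
  refine _root_.exists_iso_binaryStar hab hind fun x h1 h2 => ?_
  have : Nontrivial V := ⟨a, b, hab⟩
  obtain ⟨y, hy⟩ := hconn.preconnected.exists_adj_of_nontrivial x
  by_cases hya : y = a
  · exact .inl (hya ▸ hy.symm)
  by_cases hyb : y = b
  · exact .inr (hyb ▸ hy.symm)
  exact absurd hy (hind x y h1 h2 hya hyb)

theorem theorem3p6 {V : Type*} [Fintype V] [DecidableEq V] (G : SimpleGraph V) [DecidableRel G.Adj]
    (hconn : G.Connected) (hα : (G.indepNum : ℤ) = (Fintype.card V : ℤ) - 2) :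
    lapEigCount G (Set.Icc 0 ((Fintype.card V : ℝ) - (G.indepNum : ℝ))) = G.indepNum ↔
      (∃ p q r : ℕ, r ≤ p ∧ 3 ≤ p + q + r ∧ Nonempty (G ≃g binaryStar p q r)) ∨
      (∃ p r : ℕ, r ≤ p ∧ 2 ≤ p * r ∧ Nonempty (G ≃g binaryStar' p 0 r)) ∨
      (∃ p q r : ℕ, r ≤ p ∧ q ≠ 0 ∧ Nonempty (G ≃g binaryStar' p q r)) := by
  classical
  have hα' : G.indepNum + 2 = Fintype.card V := by omega
  have hc : (Fintype.card V : ℝ) - (G.indepNum : ℝ) = 2 := by rw [← hα']; push_cast; ring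
  rw [hc]
  constructor
  · intro h
    obtain ⟨p, q, r, hrp, ⟨⟨e⟩⟩ | ⟨⟨e⟩⟩⟩ := hconn.exists_iso_binaryStar hα'
    · refine .inl ⟨p, q, r, hrp, ?_, ⟨e⟩⟩
      by_contra! hlt
      have := card_le_lapEigCount_binaryStar_add_one (p := p) (q := q) (r := r) (by omega)
      rw [← lapEigCount_congr e, ← Fintype.card_congr e.toEquiv] at this
      omega
    · by_cases hq : q = 0
      · subst hq
        refine .inr (.inl ⟨p, r, hrp, ?_, ⟨e⟩⟩)
        by_contra! hlt
        have := card_le_lapEigCount_binaryStar'_add_one (p := p) (r := r) hrp (by omega)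
        rw [← lapEigCount_congr e, ← Fintype.card_congr e.toEquiv] at this
        omega
      · exact .inr (.inr ⟨p, q, r, hrp, hq, ⟨e⟩⟩)
  · have key' {p q r : ℕ} (e : G ≃g binaryStar' p q r) (h : q ≠ 0 ∨ 2 ≤ p * r) :
        lapEigCount G (Set.Icc 0 2) = G.indepNum := by
      have h1 := lapEigCount_binaryStar'_add_two_le h
      have h2 := card_le_lapEigCount_binaryStar'_add_two (p := p) (q := q) (r := r)
      rw [← lapEigCount_congr e, ← Fintype.card_congr e.toEquiv] at h1 h2
      omega
    rintro (⟨p, q, r, -, h, ⟨e⟩⟩ | ⟨p, r, -, h, ⟨e⟩⟩ | ⟨p, q, r, -, h, ⟨e⟩⟩)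
    -- Item 1 allows q = 0, but then the graph is disconnected.
    · have hq : q ≠ 0 := by
        rintro rfl
        exact not_connected_binaryStar_zero p r (e.connected_iff.mp hconn)
      have h1 := lapEigCount_binaryStar_add_two_le hq h
      have h2 := card_le_lapEigCount_binaryStar_add_two (p := p) (q := q) (r := r)
      rw [← lapEigCount_congr e, ← Fintype.card_congr e.toEquiv] at h1 h2
      omega
    · exact key' e (.inr h)
    · exact key' e (.inl h)
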